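/- **Setting.** A coarse space is a set $X$ with a non-empty family $\mathcal E$ of subsets of $X\times X$ (controlled entourages) closed under subsets, finite unions, transposition and composition, and containing the diagonal. A gauge is a symmetric controlled entourage containing the diagonal. A set $A\subseteq X$ is $E$-bounded if $A\times A\subseteq E$, and bounded if $A\times A\in\mathcal E$; a family is controlled if its members are all $E$-bounded for one $E\in\mathcal E$. A family $(A_i)_{i\in I}$ of subsets is uniformly locally finite if for every $E\in\mathcal E$ there is $N\in\mathbb N$ such that every $E$-bounded set meets at most $N$ of the $A_i$. $X$ has bounded geometry if it has a uniformly locally finite controlled partition. An $X$-module is a complex Hilbert space $\mathcal H$ with a unital Boolean algebra $\mathfrak A\subseteq\mathcal P(X)$ (the measurable sets) and orthogonal projections $\chi_A\in B(\mathcal H)$, $A\in\mathfrak A$, with $\chi_\emptyset=0$, $\chi_X=1$, $\chi_{A\cap B}=\chi_A\chi_B$, $\chi_{A\cup B}=\chi_A+\chi_B-\chi_A\chi_B$, such that for some gauge $E$ the spaces $\chi_A(\mathcal H)$ with $A\in\mathfrak A$ $E$-bounded span a dense subspace. Write $\mathcal H_A=\chi_A(\mathcal H)$. A discrete partition is a partition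 $X=\bigsqcup_{i\in I}A_i$ into measurable sets that are $E$-bounded for one gauge $E$, with $\sum_i\chi_{A_i}=1$ strongly, and such that $C\in\mathfrak A$ whenever $C\cap A_i\in\mathfrak A$ for all $i$. The module is discrete if it has a discrete partition. An operator $t\in B(\mathcal H)$ has controlled propagation if for some $E\in\mathcal E$ one has $\chi_Bt\chi_A=0$ for all measurable $A,B$ such that no $(y,x)\in E$ has $y\in B$, $x\in A$; it is locally compact if $\chi_At$ and $t\chi_A$ are compact for every bounded measurable $A$. $C^*_{cp}(\mathcal H)$ is the norm closure of the operators of controlled propagation, and the Roe algebra $C^*_{Roe}(\mathcal H)$ is the norm closure of the locally compact operators of controlled propagation. Given a discrete partition $\mathfrak a=(A_i)_{i\in I}$, let $E_{\mathfrak a}(t)=(\chi_{A_i}t\chi_{A_i})_{i\in I}=\sum_i\chi_{A_i}t\chi_{A_i}$ (strong sum) for $t\in B(\mathcal H)$. Let $\prod_iB(\mathcal H_{A_i})\subseteq B(\mathcal H)$ be the algebra of bounded block-diagonal operators and $\prod_iK(\mathcal H_{A_i})$ the subalgebra of those with compact blocks. Let $B\subseteq A$ be an inclusion of C*-algebras.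 A virtual commutant of $B\subseteq A$ is a pair $(\varphi,J)$ with $J$ a closed two-sided ideal of $B$ and $\varphi:J\to A$ linear with $\varphi(bx)=b\varphi(x)$ and $\varphi(xb)=\varphi(x)b$ for $x\in J$, $b\in B$. $B$ is a non-commutative Cartan subalgebra of $A$ if: (a') $\varphi(J)\subseteq B$ for every virtual commutant $(\varphi,J)$; (b) $B$ contains an approximate unit of $A$ (an increasing net of positive contractions); (c) $A$ is generated as a C*-algebra by the $n\in A$ with $nBn^*\subseteq B$ and $n^*Bn\subseteq B$; (d) there is a faithful conditional expectation $A\to B$. **Theorem.** Let $X$ be a coarse space of bounded geometry, $\mathcal H$ a discrete $X$-module, and $\mathfrak a=(A_i)_{i\in I}$ a uniformly locally finite discrete partition. Then 1. $E_{\mathfrak a}(C^*_{cp}(\mathcal H))=\prod_{i\in I}B(\mathcal H_{A_i})$, and this is a non-commutative Cartan subalgebra of $C^*_{cp}(\mathcal H)$; 2. $E_{\mathfrak a}(C^*_{Roe}(\mathcal H))=\prod_{i\in I}K(\mathcal H_{A_i})$, and this is a non-commutative Cartan subalgebra of $C^*_{Roe}(\mathcal H)$. -/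

import Mathlib

open Topology Filter

noncomputable section

namespace CoarseGeom

universe u v w

/-! ### Coarse spaces -/

/-- A coarse structure on `X`: an ideal of subsets of `X × X` (the controlled entourages) that
contains the diagonal and is closed under transposition and composition.  Connectedness is not
required. -/
class CoarseSpace (X : Type u) where
  /-- `E` is a controlled entourage. -/
  IsControlled : Set (X × X) → Prop
  controlled_diag : IsControlled {p | p.1 = p.2}
  controlled_mono : ∀ {E F : Set (X × X)}, E ⊆ F → IsControlled F → IsControlled E
  controlled_union : ∀ {E F : Set (X × X)},
    IsControlled E → IsControlled F → IsControlled (E ∪ F)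
  controlled_op : ∀ {E : Set (X × X)}, IsControlled E → IsControlled {p | (p.2, p.1) ∈ E}
  controlled_comp : ∀ {E F : Set (X × X)}, IsControlled E → IsControlled F →
    IsControlled {p | ∃ y, (p.1, y) ∈ E ∧ (y, p.2) ∈ F}


section Coarse

variable {X : Type u} [CoarseSpace X] {I : Type w}

/-- A gauge: a symmetric controlled entourage that contains the diagonal. -/
def IsGauge (E : Set (X × X)) : Prop :=
  CoarseSpace.IsControlled E ∧ (∀ x y, (x, y) ∈ E → (y, x) ∈ E) ∧ ∀ x, (x, x) ∈ E

/-- The image `R(A) = {y | ∃ x ∈ A, (y, x) ∈ R}` of a set under a relation `R ⊆ X × X`. -/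
def relImage (R : Set (X × X)) (A : Set X) : Set X := {y | ∃ x ∈ A, (y, x) ∈ R}

/-- `A` is bounded: `A × A` is a controlled entourage. -/
def IsBounded (A : Set X) : Prop := CoarseSpace.IsControlled (A ×ˢ A)

/-- A family of subsets is a partition of `X` (empty members are allowed). -/
def IsPartition (A : I → Set X) : Prop :=
  (∀ i j, i ≠ j → Disjoint (A i) (A j)) ∧ ∀ x, ∃ i, x ∈ A i

/-- A family of subsets is controlled: all of them are `E`-bounded for one entourage `E`. -/
def IsControlledFamily (A : I → Set X) : Prop :=
  ∃ E : Set (X × X), CoarseSpace.IsControlled E ∧ ∀ i, A i ×ˢ A i ⊆ E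

/-- A family is uniformly locally finite: for every entourage `E` there is a uniform bound on the
number of members that meet an `E`-bounded set. -/
def IsUniformlyLocallyFinite (A : I → Set X) : Prop :=
  ∀ E : Set (X × X), CoarseSpace.IsControlled E →
    ∃ N : ℕ, ∀ S : Set X, S ×ˢ S ⊆ E → {i | (A i ∩ S).Nonempty}.encard ≤ N

variable (X) in
/-- Bounded (coarse) geometry: there is a uniformly locally finite controlled partition. -/
def HasBoundedGeometry : Prop :=
  ∃ (J : Type u) (C : J → Set X),
    IsPartition C ∧ IsControlledFamily C ∧ IsUniformlyLocallyFinite C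

end Coarse

/-! ### Coarse geometric modules -/

/-- A coarse geometric module for `X` on the Hilbert space `H`: a unital Boolean algebra of
(measurable) subsets of `X` and a unital representation `χ` of it by orthogonal projections that is
non-degenerate, i.e. for some gauge `E` the images of the projections of `E`-bounded measurable sets
span a dense subspace. -/
structure CoarseModule (X : Type u) [CoarseSpace X] (H : Type v) [NormedAddCommGroup H]
    [InnerProductSpace ℂ H] [CompleteSpace H] where
  /-- the measurable sets -/
  meas : BooleanSubalgebra (Set X)
  /-- the projection of a measurable set -/
  χ : meas → H →L[ℂ] H
  χ_bot : χ ⊥ = 0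
  χ_top : χ ⊤ = 1
  χ_inf : ∀ A B, χ (A ⊓ B) = χ A * χ B
  χ_sup : ∀ A B, χ (A ⊔ B) = χ A + χ B - χ A * χ B
  χ_star : ∀ A, star (χ A) = χ A
  nondegenerate : ∃ E : Set (X × X), IsGauge E ∧
    Dense (Submodule.span ℂ
      {v : H | ∃ A : meas, (A : Set X) ×ˢ (A : Set X) ⊆ E ∧ ∃ w, χ A w = v} : Set H)

namespace CoarseModule

variable {X : Type u} [CoarseSpace X] {H : Type v} [NormedAddCommGroup H]
  [InnerProductSpace ℂ H] [CompleteSpace H] (M : CoarseModule X H) {I : Type w}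

/-- `(A i)` is a discrete partition for the module: a partition of `X` into measurable sets that are
`E`-bounded for one gauge `E`, whose projections sum strongly to `1`, and that detects
measurability. -/
structure IsDiscretePartition (a : I → M.meas) : Prop where
  partition : IsPartition fun i => (a i : Set X)
  controlled : ∃ E : Set (X × X), IsGauge E ∧ ∀ i, (a i : Set X) ×ˢ (a i : Set X) ⊆ E
  hasSum : ∀ v : H, HasSum (fun i => M.χ (a i) v) v
  mem_of_inter_mem : ∀ C : Set X, (∀ i, C ∩ (a i : Set X) ∈ M.meas) → C ∈ M.meas

/-- The module is discrete: it has a discrete partition. -/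
def IsDiscrete : Prop := ∃ (J : Type u) (a : J → M.meas), M.IsDiscretePartition a

/-- `Supp(t) ⊆ S`: one has `χ_B t χ_A = 0` whenever `B` and `A` are measurable and `S`-separated. -/
def SuppSubset (t : H →L[ℂ] H) (S : Set (X × X)) : Prop :=
  ∀ B A : M.meas, (B : Set X) ∩ relImage S (A : Set X) = ∅ → M.χ B * t * M.χ A = 0

/-- `t` has controlled propagation: its support is contained in a controlled entourage. -/
def HasControlledPropagation (t : H →L[ℂ] H) : Prop :=
  ∃ E : Set (X × X), CoarseSpace.IsControlled E ∧ M.SuppSubset t E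

/-- `t` is locally compact: `χ_A t` and `t χ_A` are compact for every bounded measurable `A`. -/
def IsLocallyCompact (t : H →L[ℂ] H) : Prop :=
  ∀ A : M.meas, IsBounded (A : Set X) →
    IsCompactOperator (M.χ A * t) ∧ IsCompactOperator (t * M.χ A)

/-! #### Auxiliary facts -/

lemma χ_mul_self (A : M.meas) : M.χ A * M.χ A = M.χ A := by
  rw [← M.χ_inf, inf_idem]

lemma χ_comm (A B : M.meas) : M.χ A * M.χ B = M.χ B * M.χ A := by
  rw [← M.χ_inf, ← M.χ_inf, inf_comm]

lemma χ_apply_self (A : M.meas) (v : H) : M.χ A (M.χ A v) = M.χ A v :=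
  DFunLike.congr_fun (M.χ_mul_self A) v

lemma χ_apply_disjoint {A B : M.meas} (h : Disjoint (A : Set X) (B : Set X)) (v : H) :
    M.χ A (M.χ B v) = 0 := by
  have h1 : A ⊓ B = ⊥ := Subtype.ext (disjoint_iff.mp h)
  have h2 : M.χ A * M.χ B = 0 := by rw [← M.χ_inf, h1, M.χ_bot]
  exact DFunLike.congr_fun h2 v

lemma inner_χ (A : M.meas) (v w : H) : inner ℂ (M.χ A v) w = inner ℂ v (M.χ A w) := by
  conv_rhs => rw [← M.χ_star A]
  rw [ContinuousLinearMap.star_eq_adjoint, ContinuousLinearMap.adjoint_inner_right]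

lemma norm_χ_apply_le (A : M.meas) (v : H) : ‖M.χ A v‖ ≤ ‖v‖ := by
  by_cases h : ‖M.χ A v‖ = 0
  · rw [h]; exact norm_nonneg v
  have h1 : ‖M.χ A v‖ * ‖M.χ A v‖ ≤ ‖M.χ A v‖ * ‖v‖ := by
    rw [← inner_self_eq_norm_mul_norm (𝕜 := ℂ), M.inner_χ, M.χ_apply_self, ← M.inner_χ]
    exact (RCLike.re_le_norm _).trans (norm_inner_le_norm _ _)
  exact le_of_mul_le_mul_left h1 (lt_of_le_of_ne (norm_nonneg _) (Ne.symm h))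

/-- An operator that kills `χ_C w` for all `E`-bounded measurable `C`, where `E` witnesses
non-degeneracy, kills `w`. -/
lemma eq_zero_of_forall_bounded {E : Set (X × X)}
    (hE : Dense (Submodule.span ℂ
      {v : H | ∃ A : M.meas, (A : Set X) ×ˢ (A : Set X) ⊆ E ∧ ∃ w, M.χ A w = v} : Set H))
    (q : H →L[ℂ] H) (w : H)
    (h : ∀ C : M.meas, (C : Set X) ×ˢ (C : Set X) ⊆ E → q (M.χ C w) = 0) : q w = 0 := by
  set S : Set H := {v : H | ∃ A : M.meas, (A : Set X) ×ˢ (A : Set X) ⊆ E ∧ ∃ w, M.χ A w = v}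
    with hS
  have key : ∀ x ∈ Submodule.span ℂ S, ∃ U : M.meas, M.χ U x = x ∧
      ∀ D : M.meas, q (M.χ (U ⊓ D) w) = 0 := by
    intro x hx
    induction hx using Submodule.span_induction with
    | mem x hx =>
      obtain ⟨A, hA, y, rfl⟩ := hx
      refine ⟨A, M.χ_apply_self A y, fun D => h _ ?_⟩
      exact (Set.prod_mono Set.inter_subset_left Set.inter_subset_left).trans hA
    | zero => exact ⟨⊥, by simp, fun D => by simp [M.χ_bot]⟩
    | add x y _ _ hx hy =>
      obtain ⟨U, hU, hU'⟩ := hx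
      obtain ⟨V, hV, hV'⟩ := hy
      have hUV : ∀ z, M.χ (U ⊔ V) z = M.χ U z + M.χ V z - M.χ U (M.χ V z) := fun z =>
        DFunLike.congr_fun (M.χ_sup U V) z
      refine ⟨U ⊔ V, ?_, fun D => ?_⟩
      · have hc : M.χ U (M.χ V x) = M.χ V (M.χ U x) :=
          DFunLike.congr_fun (M.χ_comm U V) x
        rw [map_add, hUV, hUV, hV, hU, hc, hU]
        abel
      · have h1 : (U ⊔ V) ⊓ D = (U ⊓ D) ⊔ (V ⊓ D) := inf_sup_right _ _ _
        have h2 : M.χ ((U ⊓ D) ⊔ (V ⊓ D)) w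
            = M.χ (U ⊓ D) w + M.χ (V ⊓ D) w - M.χ (U ⊓ (D ⊓ (V ⊓ D))) w := by
          have h3 : U ⊓ (D ⊓ (V ⊓ D)) = (U ⊓ D) ⊓ (V ⊓ D) := (inf_assoc _ _ _).symm
          rw [h3, M.χ_sup, M.χ_inf (U ⊓ D)]
          rfl
        rw [h1, h2, map_sub, map_add, hU', hV', hU']
        simp
    | smul c x _ hx =>
      obtain ⟨U, hU, hU'⟩ := hx
      exact ⟨U, by rw [map_smul, hU], hU'⟩
  rw [← norm_le_zero_iff]
  refine le_of_forall_pos_le_add fun ε hε => ?_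
  have hδ : 0 < ε / (2 * (‖q‖ + 1)) := by positivity
  obtain ⟨x, hx, hxS⟩ := Metric.dense_iff.mp hE w _ hδ
  obtain ⟨U, hU, hU'⟩ := key x hxS
  have h0 : q (M.χ U w) = 0 := by simpa using hU' ⊤
  have hx' : ‖x - w‖ < ε / (2 * (‖q‖ + 1)) := by simpa [dist_eq_norm] using hx
  have h1 : q w = q (M.χ U (x - w)) - q (x - w) := by
    simp only [map_sub, h0, hU]; abel
  have h2 : ‖q w‖ ≤ ‖q‖ * ‖x - w‖ + ‖q‖ * ‖x - w‖ := by
    rw [h1]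
    refine (norm_sub_le _ _).trans (add_le_add ?_ (q.le_opNorm _))
    exact (q.le_opNorm _).trans
      (mul_le_mul_of_nonneg_left (M.norm_χ_apply_le _ _) (norm_nonneg _))
  have h3 : (‖q‖ + 1) * ‖x - w‖ ≤ ε / 2 := by
    have := mul_le_mul_of_nonneg_left hx'.le (by positivity : 0 ≤ ‖q‖ + 1)
    refine this.trans (le_of_eq ?_)
    field_simp
  nlinarith [norm_nonneg (x - w)]

lemma SuppSubset.mono {t : H →L[ℂ] H} {S T : Set (X × X)} (h : M.SuppSubset t S) (hST : S ⊆ T) :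
    M.SuppSubset t T := fun B A hBA => h B A <| by
  rw [Set.eq_empty_iff_forall_notMem] at hBA ⊢
  rintro x ⟨hxB, y, hyA, hyx⟩
  exact hBA x ⟨hxB, y, hyA, hST hyx⟩

lemma HasControlledPropagation.add {s t : H →L[ℂ] H} (hs : M.HasControlledPropagation s)
    (ht : M.HasControlledPropagation t) : M.HasControlledPropagation (s + t) := by
  obtain ⟨E, hE, hsE⟩ := hs
  obtain ⟨F, hF, htF⟩ := ht
  refine ⟨E ∪ F, CoarseSpace.controlled_union hE hF, fun B A hBA => ?_⟩
  rw [mul_add, add_mul, SuppSubset.mono M hsE Set.subset_union_left B A hBA,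
    SuppSubset.mono M htF Set.subset_union_right B A hBA, add_zero]

lemma HasControlledPropagation.smul (c : ℂ) {t : H →L[ℂ] H}
    (ht : M.HasControlledPropagation t) : M.HasControlledPropagation (c • t) := by
  obtain ⟨F, hF, htF⟩ := ht
  exact ⟨F, hF, fun B A hBA => by
    rw [mul_smul_comm, smul_mul_assoc, htF B A hBA, smul_zero]⟩

lemma HasControlledPropagation.zero : M.HasControlledPropagation (0 : H →L[ℂ] H) :=
  ⟨_, CoarseSpace.controlled_diag, fun B A _ => by simp⟩

lemma HasControlledPropagation.star {t : H →L[ℂ] H}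
    (ht : M.HasControlledPropagation t) : M.HasControlledPropagation (star t) := by
  obtain ⟨F, hF, htF⟩ := ht
  refine ⟨_, CoarseSpace.controlled_op hF, fun B A hBA => ?_⟩
  have h1 : M.χ A * t * M.χ B = 0 := by
    refine htF A B ?_
    rw [Set.eq_empty_iff_forall_notMem] at hBA ⊢
    rintro x ⟨hxA, y, hyB, hyx⟩
    exact hBA y ⟨hyB, x, hxA, hyx⟩
  have h2 := congrArg Star.star h1
  simpa [M.χ_star, mul_assoc] using h2

lemma HasControlledPropagation.mul {s t : H →L[ℂ] H} (hs : M.HasControlledPropagation s)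
    (ht : M.HasControlledPropagation t) : M.HasControlledPropagation (s * t) := by
  obtain ⟨E, hE, hsE⟩ := hs
  obtain ⟨F, hF, htF⟩ := ht
  obtain ⟨G, hG, hd⟩ := M.nondegenerate
  refine ⟨_, CoarseSpace.controlled_comp hE (CoarseSpace.controlled_comp hG.1 hF),
    fun B A hBA => ?_⟩
  ext v
  refine M.eq_zero_of_forall_bounded hd (M.χ B * s) (t (M.χ A v)) fun C hC => ?_
  by_cases h1 : (B : Set X) ∩ relImage E (C : Set X) = ∅
  · exact DFunLike.congr_fun (hsE B C h1) (t (M.χ A v))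
  by_cases h2 : (C : Set X) ∩ relImage F (A : Set X) = ∅
  · have h3 : M.χ C (t (M.χ A v)) = 0 := DFunLike.congr_fun (htF C A h2) v
    rw [h3, map_zero]
  exfalso
  obtain ⟨x, hxB, y, hyC, hxy⟩ := Set.nonempty_iff_ne_empty.mpr h1
  obtain ⟨z, hzC, u, huA, hzu⟩ := Set.nonempty_iff_ne_empty.mpr h2
  have : x ∈ (∅ : Set X) := by
    rw [← hBA]
    exact ⟨hxB, u, huA, y, hxy, z, hC ⟨hyC, hzC⟩, hzu⟩
  exact this

/-- The adjoint of a compact operator on a Hilbert space is compact. -/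
lemma isCompactOperator_star {t : H →L[ℂ] H} (ht : IsCompactOperator t) :
    IsCompactOperator (star t : H →L[ℂ] H) := by
  have hc : IsCompactOperator (t * star t : H →L[ℂ] H) := ht.comp_clm (star t)
  replace hc := (isCompactOperator_iff_isCompact_closure_image_closedBall
    (t * star t : H →L[ℂ] H).toLinearMap one_pos).mp hc
  refine (isCompactOperator_iff_isCompact_closure_image_closedBall
    (star t : H →L[ℂ] H).toLinearMap one_pos).mpr ?_
  have htb : TotallyBounded ((t * star t : H →L[ℂ] H) '' Metric.closedBall 0 1) :=
    hc.totallyBounded.subset subset_closure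
  refine isCompact_iff_totallyBounded_isComplete.mpr
    ⟨TotallyBounded.closure ?_, isClosed_closure.isComplete⟩
  rw [Metric.totallyBounded_iff]
  intro ε hε
  obtain ⟨T, hT, hTfin, hcov⟩ := Metric.finite_approx_of_totallyBounded htb (ε ^ 2 / 2)
    (by positivity)
  have hT' : ∀ y ∈ T, ∃ x, x ∈ Metric.closedBall (0 : H) 1 ∧ (t * star t : H →L[ℂ] H) x = y :=
    fun y hy => hT hy
  choose! f hfb hf using hT'
  refine ⟨(fun y => star t (f y)) '' T, hTfin.image _, ?_⟩
  rintro _ ⟨x, hx, rfl⟩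
  obtain ⟨y, hyT, hxy⟩ := Set.mem_iUnion₂.mp (hcov ⟨x, hx, rfl⟩)
  refine Set.mem_iUnion₂.mpr ⟨_, ⟨y, hyT, rfl⟩, ?_⟩
  rw [← hf y hyT, mem_ball_iff_norm, ← map_sub] at hxy
  rw [mem_ball_iff_norm]
  change ‖star t x - star t (f y)‖ < ε
  rw [← map_sub]
  have hz : ‖x - f y‖ ≤ 2 := by
    have h1 := mem_closedBall_zero_iff.mp hx
    have h2 := mem_closedBall_zero_iff.mp (hfb y hyT)
    linarith [norm_sub_le x (f y)]
  set z := x - f y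
  have h3 : ‖star t z‖ * ‖star t z‖ ≤ ‖(t * star t) z‖ * ‖z‖ := by
    rw [← inner_self_eq_norm_mul_norm (𝕜 := ℂ)]
    have : inner ℂ (star t z) (star t z) = inner ℂ ((t * star t) z) z := by
      conv_lhs => rw [ContinuousLinearMap.star_eq_adjoint,
        ContinuousLinearMap.adjoint_inner_right]
      rfl
    rw [this]
    exact (RCLike.re_le_norm _).trans (norm_inner_le_norm _ _)
  have h4 : ‖star t z‖ ^ 2 < ε ^ 2 := by
    have := norm_nonneg ((t * star t) z)
    nlinarith
  exact lt_of_pow_lt_pow_left₀ 2 hε.le h4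

/-! #### The algebras -/

/-- The `*`-algebra of operators of controlled propagation. -/
def cpStar : NonUnitalStarSubalgebra ℂ (H →L[ℂ] H) where
  carrier := {t | M.HasControlledPropagation t}
  add_mem' hs ht := HasControlledPropagation.add M hs ht
  zero_mem' := HasControlledPropagation.zero M
  mul_mem' hs ht := HasControlledPropagation.mul M hs ht
  smul_mem' c _ ht := HasControlledPropagation.smul M c ht
  star_mem' ht := HasControlledPropagation.star M ht

/-- The Roe `*`-algebra: locally compact operators of controlled propagation. -/
def roeStar : NonUnitalStarSubalgebra ℂ (H →L[ℂ] H) where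
  carrier := {t | M.HasControlledPropagation t ∧ M.IsLocallyCompact t}
  add_mem' {s t} hs ht := ⟨HasControlledPropagation.add M hs.1 ht.1, fun A hA => by
    rw [mul_add, add_mul]
    exact ⟨(hs.2 A hA).1.add (ht.2 A hA).1, (hs.2 A hA).2.add (ht.2 A hA).2⟩⟩
  zero_mem' := ⟨HasControlledPropagation.zero M, fun A _ => by
    rw [mul_zero, zero_mul]
    exact ⟨isCompactOperator_zero, isCompactOperator_zero⟩⟩
  mul_mem' {s t} hs ht := ⟨HasControlledPropagation.mul M hs.1 ht.1, fun A hA =>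
    ⟨(hs.2 A hA).1.comp_clm t, (ht.2 A hA).2.clm_comp s⟩⟩
  smul_mem' c t ht := ⟨HasControlledPropagation.smul M c ht.1, fun A hA => by
    rw [mul_smul_comm, smul_mul_assoc]
    exact ⟨(ht.2 A hA).1.smul c, (ht.2 A hA).2.smul c⟩⟩
  star_mem' {t} ht := ⟨HasControlledPropagation.star M ht.1, fun A hA => by
    have h1 := isCompactOperator_star (ht.2 A hA).1
    have h2 := isCompactOperator_star (ht.2 A hA).2
    rw [star_mul, M.χ_star] at h1 h2
    exact ⟨h2, h1⟩⟩

/-- The C*-algebra of operators of controlled propagation. -/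
def cpCStar : NonUnitalStarSubalgebra ℂ (H →L[ℂ] H) := M.cpStar.topologicalClosure

/-- The Roe C*-algebra. -/
def roeCStar : NonUnitalStarSubalgebra ℂ (H →L[ℂ] H) := M.roeStar.topologicalClosure

/-! #### Block-diagonal operators -/

section Blocks

variable (a : I → M.meas)

/-- The algebra `∏ i, B(H_{A i})` of bounded block-diagonal operators on `H = ⨁ H_{A i}`: the
operators that commute with all projections `χ_{A i}`.  (The projections of a discrete partition sum
to `1`, so these are the operators that map every `H_{A i}` to itself.) -/
def prodBounded : NonUnitalStarSubalgebra ℂ (H →L[ℂ] H) where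
  carrier := {t | ∀ i, M.χ (a i) * t = t * M.χ (a i)}
  add_mem' {s t} hs ht i := by rw [mul_add, add_mul, hs i, ht i]
  zero_mem' i := by rw [mul_zero, zero_mul]
  mul_mem' {s t} hs ht i := by rw [← mul_assoc, hs i, mul_assoc, ht i, mul_assoc]
  smul_mem' c t ht i := by rw [mul_smul_comm, smul_mul_assoc, ht i]
  star_mem' {t} ht i := by
    have h := congrArg Star.star (ht i)
    rw [star_mul, star_mul, M.χ_star] at h
    exact h.symm

/-- The algebra `∏ i, K(H_{A i})` of bounded block-diagonal operators with compact blocks. -/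
def prodCompact : NonUnitalStarSubalgebra ℂ (H →L[ℂ] H) where
  carrier := {t | t ∈ M.prodBounded a ∧ ∀ i, IsCompactOperator (M.χ (a i) * t * M.χ (a i))}
  add_mem' {s t} hs ht := ⟨add_mem hs.1 ht.1, fun i => by
    rw [mul_add, add_mul]; exact (hs.2 i).add (ht.2 i)⟩
  zero_mem' := ⟨zero_mem _, fun i => by
    rw [mul_zero, zero_mul]; exact isCompactOperator_zero⟩
  mul_mem' {s t} hs ht := ⟨mul_mem hs.1 ht.1, fun i => by
    have h : M.χ (a i) * (s * t) * M.χ (a i) = M.χ (a i) * s * M.χ (a i) * t := by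
      have h1 : ∀ i, M.χ (a i) * t = t * M.χ (a i) := ht.1
      rw [mul_assoc, mul_assoc s, ← h1 i]
      simp only [mul_assoc]
    rw [h]; exact (hs.2 i).comp_clm t⟩
  smul_mem' c t ht := ⟨SMulMemClass.smul_mem c ht.1, fun i => by
    rw [mul_smul_comm, smul_mul_assoc]; exact (ht.2 i).smul c⟩
  star_mem' {t} ht := ⟨star_mem ht.1, fun i => by
    have h := isCompactOperator_star (ht.2 i)
    rwa [star_mul, star_mul, M.χ_star, ← mul_assoc] at h⟩

variable {a}

lemma norm_sum_blocks_le (ha : M.IsDiscretePartition a) (t : H →L[ℂ] H) (v : H) (s : Finset I) :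
    ‖∑ i ∈ s, M.χ (a i) (t (M.χ (a i) v))‖ ≤ ‖t‖ * ‖∑ i ∈ s, M.χ (a i) v‖ := by
  have hV : OrthogonalFamily ℂ (fun i => (LinearMap.range (M.χ (a i)).toLinearMap))
      (fun i => (LinearMap.range (M.χ (a i)).toLinearMap).subtypeₗᵢ) := by
    rintro i j hij ⟨_, x, rfl⟩ ⟨_, y, rfl⟩
    change inner ℂ (M.χ (a i) x) (M.χ (a j) y) = 0
    rw [M.inner_χ, M.χ_apply_disjoint (ha.partition.1 i j hij), inner_zero_right]
  have h1 : ∀ f : I → H, ‖∑ i ∈ s, M.χ (a i) (f i)‖ ^ 2 = ∑ i ∈ s, ‖M.χ (a i) (f i)‖ ^ 2 :=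
    fun f => hV.norm_sum (fun i => ⟨M.χ (a i) (f i), f i, rfl⟩) s
  refine le_of_sq_le_sq ?_ (by positivity)
  rw [mul_pow, h1, h1, Finset.mul_sum]
  refine Finset.sum_le_sum fun i _ => ?_
  rw [← mul_pow]
  gcongr
  exact (M.norm_χ_apply_le _ _).trans (t.le_opNorm _)

lemma summable_blocks (ha : M.IsDiscretePartition a) (t : H →L[ℂ] H) (v : H) :
    Summable fun i => M.χ (a i) (t (M.χ (a i) v)) := by
  rw [summable_iff_vanishing_norm]
  intro ε hε
  obtain ⟨s, hs⟩ := summable_iff_vanishing_norm.mp (ha.hasSum v).summable (ε / (‖t‖ + 1))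
    (by positivity)
  refine ⟨s, fun T hT => ?_⟩
  refine (M.norm_sum_blocks_le ha t v T).trans_lt ?_
  have h1 := hs T hT
  rw [lt_div_iff₀ (by positivity)] at h1
  nlinarith [norm_nonneg (∑ i ∈ T, M.χ (a i) v)]

/-- The map `t ↦ (χ_{A i} t χ_{A i})_i` from `B(H)` to `∏ i, B(H_{A i})`, the element on the right
being the operator `∑ i, χ_{A i} t χ_{A i}` on `H` (a strongly convergent sum). -/
def condExp (ha : M.IsDiscretePartition a) (t : H →L[ℂ] H) : H →L[ℂ] H :=
  LinearMap.mkContinuous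
    { toFun := fun v => ∑' i, M.χ (a i) (t (M.χ (a i) v))
      map_add' := fun v w => by
        simp only [map_add]
        exact (M.summable_blocks ha t v).tsum_add (M.summable_blocks ha t w)
      map_smul' := fun c v => by
        simp only [map_smul, RingHom.id_apply]
        exact (M.summable_blocks ha t v).tsum_const_smul c }
    ‖t‖ fun v => by
      refine le_of_tendsto_of_tendsto (M.summable_blocks ha t v).hasSum.norm
        ((ha.hasSum v).norm.const_mul ‖t‖) (Eventually.of_forall fun s => ?_)
      exact M.norm_sum_blocks_le ha t v s

lemma hasSum_condExp (ha : M.IsDiscretePartition a) (t : H →L[ℂ] H) (v : H) :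
    HasSum (fun i => M.χ (a i) (t (M.χ (a i) v))) (M.condExp ha t v) :=
  (M.summable_blocks ha t v).hasSum

end Blocks

end CoarseModule

/-! ### Non-commutative Cartan subalgebras

An inclusion of C*-algebras `B ⊆ A` is given by two closed `*`-subalgebras of a C*-algebra `𝓜`. -/

section Cartan

variable {𝓜 : Type v} [NonUnitalCStarAlgebra 𝓜] [PartialOrder 𝓜] [StarOrderedRing 𝓜]

/-- The normalizers of `B` in `A`. -/
def normalizers (B A : NonUnitalStarSubalgebra ℂ 𝓜) : Set 𝓜 :=
  {n | n ∈ A ∧ ∀ b ∈ B, n * b * star n ∈ B ∧ star n * b * n ∈ B}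

/-- `B` contains an approximate unit of `A`: an increasing net of positive contractions in `B` that
is an approximate unit of `A`. -/
def ContainsApproximateUnit (B A : NonUnitalStarSubalgebra ℂ 𝓜) : Prop :=
  ∃ (Λ : Type v) (_ : Preorder Λ) (_ : IsDirectedOrder Λ) (_ : Nonempty Λ) (e : Λ → 𝓜),
    Monotone e ∧ (∀ l, e l ∈ B ∧ 0 ≤ e l ∧ ‖e l‖ ≤ 1) ∧
      ∀ x ∈ A, Tendsto (fun l => e l * x) atTop (𝓝 x) ∧ Tendsto (fun l => x * e l) atTop (𝓝 x)

/-- `E : A → B` is a conditional expectation: a positive contractive linear `B`-bimodule map that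
restricts to the identity on `B`. -/
structure IsConditionalExpectation (B A : NonUnitalStarSubalgebra ℂ 𝓜) (E : A →ₗ[ℂ] B) :
    Prop where
  map_of_mem : ∀ x : A, (x : 𝓜) ∈ B → (E x : 𝓜) = x
  positive : ∀ x : A, 0 ≤ (E (star x * x) : 𝓜)
  contractive : ∀ x : A, ‖(E x : 𝓜)‖ ≤ ‖(x : 𝓜)‖
  map_mul_left : ∀ b x : A, (b : 𝓜) ∈ B → (E (b * x) : 𝓜) = b * E x
  map_mul_right : ∀ x b : A, (b : 𝓜) ∈ B → (E (x * b) : 𝓜) = E x * b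

/-- `E` is faithful: `E(x⋆ x) = 0` only for `x = 0`. -/
def IsFaithfulMap (B A : NonUnitalStarSubalgebra ℂ 𝓜) (E : A →ₗ[ℂ] B) : Prop :=
  ∀ x : A, E (star x * x) = 0 → x = 0

/-- `(φ, J)` is a virtual commutant of `B ⊆ A`: `J` is a closed two-sided ideal of `B` and
`φ : J → A` is a linear map with `φ(b x) = b φ(x)` and `φ(x b) = φ(x) b` for `x ∈ J`, `b ∈ B`. -/
structure IsVirtualCommutant (B A : NonUnitalStarSubalgebra ℂ 𝓜) (J : Submodule ℂ 𝓜)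
    (φ : J →ₗ[ℂ] A) : Prop where
  le : ∀ x ∈ J, x ∈ B
  closed : IsClosed (J : Set 𝓜)
  mul_mem_left : ∀ b ∈ B, ∀ x ∈ J, b * x ∈ J
  mul_mem_right : ∀ x ∈ J, ∀ b ∈ B, x * b ∈ J
  map_mul_left : ∀ (b : 𝓜) (hb : b ∈ B) (x : J),
    (φ ⟨b * x, mul_mem_left b hb x x.2⟩ : 𝓜) = b * φ x
  map_mul_right : ∀ (x : J) (b : 𝓜) (hb : b ∈ B),
    (φ ⟨x * b, mul_mem_right x x.2 b hb⟩ : 𝓜) = φ x * b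

/-- `B ⊆ A` is an inclusion of C*-algebras and `B` is a non-commutative Cartan subalgebra of `A`. -/
structure IsNCCartan (B A : NonUnitalStarSubalgebra ℂ 𝓜) : Prop where
  isClosed_sub : IsClosed (B : Set 𝓜)
  isClosed_alg : IsClosed (A : Set 𝓜)
  le : B ≤ A
  image_virtual_commutant : ∀ (J : Submodule ℂ 𝓜) (φ : J →ₗ[ℂ] A),
    IsVirtualCommutant B A J φ → ∀ x, (φ x : 𝓜) ∈ B
  approximate_unit : ContainsApproximateUnit B A
  generated : (NonUnitalStarAlgebra.adjoin ℂ (normalizers B A)).topologicalClosure = A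
  faithful_expectation : ∃ E : A →ₗ[ℂ] B, IsConditionalExpectation B A E ∧ IsFaithfulMap B A E

end Cartan

end CoarseGeom

end

namespace CoarseGeom

universe u v w

/-! Write t as a matrix of blocks χ_i t χ_j, with χ_i the projection of A_i. Controlled propagation
and uniform local finiteness bound the number of non-zero blocks in each row and column. More is
true: indices that can share a row or column are related by one entourage, so finitely many colours
separate them. Cutting t on both sides by the projections of the colour classes writes it as a
finite sum of operators n with at most one non-zero block per row and column
(`exists_block_matching_decomposition`). For block-diagonal b, each off-diagonal block of n b n⋆
vanishes, so these n are normalizers.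

This gives generation. Since also n n⋆ ∈ B, the C⋆-identity turns an approximate unit of B into one
of the whole algebra (`containsApproximateUnit_of_mul_star_mem`). The compression to diagonal blocks
is the conditional expectation. It is faithful because the diagonal blocks of t⋆t are (tχ_i)⋆(tχ_i).

For a virtual commutant φ, k x l = 0 forces k φ(x) l = 0 for k, l ∈ B. With k = χ_i and l = χ_j this
kills the off-diagonal blocks of φ(x). In the Roe case the χ_i need not be compact, and rank-one
operators inside the blocks replace them. Both cases are instances of
`isNCCartan_topologicalClosure`. -/

/-! ### Colouring relations of bounded degree. -/

/-- Greedy colouring: a symmetric relation of bounded degree has a finite proper colouring. -/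
theorem exists_finite_coloring {I : Type w} (r : I → I → Prop) (hr : ∀ i j, r i j → r j i) (N : ℕ)
    (hN : ∀ i, {j | r i j}.encard ≤ N) :
    ∃ c : I → Fin (N + 1), ∀ i j, r i j → i ≠ j → c i ≠ c j := by
  classical
  have hfresh : ∀ (i : I) (f : ∀ j, WellOrderingRel j i → Fin (N + 1)),
      ∃ k : Fin (N + 1), ∀ j (hj : WellOrderingRel j i), r i j → f j hj ≠ k := by
    intro i f
    -- If every colour were taken by a related predecessor, the colour could be read off from that
    -- predecessor, so i would have N + 1 distinct related indices.
    by_contra! hcon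
    choose g hg hrg hfg using hcon
    have hinj : Function.Injective g := fun k l hkl => by
      rw [← hfg k, ← hfg l]
      congr 1
    have h1 : (Set.range g).encard ≤ N :=
      (Set.encard_le_encard (by rintro _ ⟨k, rfl⟩; exact hrg k)).trans (hN i)
    rw [← Set.image_univ, hinj.encard_image, Set.encard_univ] at h1
    simp only [ENat.card_eq_coe_fintype_card, Fintype.card_fin] at h1
    have h2 : N + 1 ≤ N := by exact_mod_cast h1
    omega
  let wf : WellFounded (WellOrderingRel : I → I → Prop) := IsWellFounded.wf
  let c : I → Fin (N + 1) := wf.fix fun i f => (hfresh i f).choose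
  have hc : ∀ i j, WellOrderingRel j i → r i j → c j ≠ c i := by
    intro i j hji hij
    have h1 : c i = (hfresh i fun j _ => c j).choose := wf.fix_eq _ i
    rw [h1]
    exact (hfresh i fun j _ => c j).choose_spec j hji hij
  -- The recursion only compares an index with its predecessors; symmetry of r covers the other
  -- order.
  refine ⟨c, fun i j hij hne => ?_⟩
  rcases trichotomous_of WellOrderingRel i j with h | h | h
  · exact hc j i h (hr _ _ hij)
  · exact absurd h hne
  · exact (hc i j h hij).symm

/-! ### Passing approximate units from a subalgebra to the algebra. -/

section ApproximateUnit

variable {𝓜 : Type v} [NonUnitalCStarAlgebra 𝓜]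

/-- With d = e n n⋆ − n n⋆ one has (en − n)(en − n)⋆ = de − d, so the C⋆-identity gives ‖en − n‖² ≤
2‖d‖. -/
theorem tendsto_mul_of_tendsto_mul_mul_star {Λ : Type*} {l : Filter Λ} {e : Λ → 𝓜}
    (he : ∀ i, star (e i) = e i) (he1 : ∀ i, ‖e i‖ ≤ 1) {n : 𝓜}
    (h : Tendsto (fun i => e i * (n * star n)) l (𝓝 (n * star n))) :
    Tendsto (fun i => e i * n) l (𝓝 n) := by
  rw [tendsto_iff_norm_sub_tendsto_zero] at h ⊢
  have hle : ∀ i, ‖e i * n - n‖ ^ 2 ≤ 2 * ‖e i * (n * star n) - n * star n‖ := by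
    intro i
    set d := e i * (n * star n) - n * star n
    have h1 : (e i * n - n) * star (e i * n - n) = d * e i - d := by
      simp only [d, star_sub, star_mul, he, mul_sub, sub_mul, mul_assoc]
    rw [sq, ← CStarRing.norm_self_mul_star, h1]
    calc ‖d * e i - d‖ ≤ ‖d‖ * ‖e i‖ + ‖d‖ := (norm_sub_le _ _).trans (by gcongr; exact norm_mul_le _ _)
      _ ≤ 2 * ‖d‖ := by nlinarith [he1 i, norm_nonneg d]
  have h2 : Tendsto (fun i => ‖e i * n - n‖ ^ 2) l (𝓝 0) := by
    refine squeeze_zero (fun _ => by positivity) hle ?_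
    simpa using h.const_mul 2
  have h3 := h2.sqrt
  simpa [Real.sqrt_sq] using h3

theorem tendsto_mul_of_mem_closure_span {Λ : Type*} {l : Filter Λ} {e : Λ → 𝓜}
    (he1 : ∀ i, ‖e i‖ ≤ 1) {S : Set 𝓜} (hS : ∀ n ∈ S, Tendsto (fun i => e i * n) l (𝓝 n))
    {x : 𝓜} (hx : x ∈ closure (Submodule.span ℂ S : Set 𝓜)) :
    Tendsto (fun i => e i * x) l (𝓝 x) := by
  have hspan : ∀ y ∈ Submodule.span ℂ S, Tendsto (fun i => e i * y) l (𝓝 y) := by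
    intro y hy
    induction hy using Submodule.span_induction with
    | mem y hy => exact hS y hy
    | zero => simpa using tendsto_const_nhds
    | add y z _ _ hy hz => simpa only [mul_add] using hy.add hz
    | smul c y _ hy => simpa only [mul_smul_comm] using hy.const_smul c
  rw [Metric.tendsto_nhds]
  intro ε hε
  obtain ⟨y, hy, hxy⟩ := Metric.mem_closure_iff.mp hx (ε / 3) (by positivity)
  filter_upwards [Metric.tendsto_nhds.mp (hspan y hy) (ε / 3) (by positivity)] with i hi
  rw [dist_eq_norm] at hi hxy ⊢
  have h1 : e i * x - x = e i * (x - y) + (e i * y - y) - (x - y) := by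
    rw [mul_sub]; abel
  have h2 : ‖e i * (x - y)‖ ≤ ‖x - y‖ :=
    (norm_mul_le _ _).trans (mul_le_of_le_one_left (norm_nonneg _) (he1 i))
  calc ‖e i * x - x‖ ≤ ‖e i * (x - y)‖ + ‖e i * y - y‖ + ‖x - y‖ := by
        rw [h1]; exact (norm_sub_le _ _).trans (by gcongr; exact norm_add_le _ _)
    _ < ε := by linarith

/-- The increasing approximate unit of a C*-algebra as a net; the order is expressed by positive
elements `y⋆ y`. -/
theorem exists_increasing_net (𝓑 : Type v) [NonUnitalCStarAlgebra 𝓑] :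
    ∃ (Λ : Type v) (_ : Preorder Λ) (_ : IsDirectedOrder Λ) (_ : Nonempty Λ) (e : Λ → 𝓑),
      (∀ l l', l ≤ l' → ∃ y, e l' - e l = star y * y) ∧ (∀ l, ∃ y, e l = star y * y) ∧
      (∀ l, ‖e l‖ ≤ 1) ∧ ∀ b, Tendsto (fun l => e l * b) atTop (𝓝 b) := by
  -- This order is internal to the proof. Elements y⋆y stay positive under an inclusion into a
  -- larger C⋆-algebra, whatever order was chosen on 𝓑.
  let _ : PartialOrder 𝓑 := CStarAlgebra.spectralOrder 𝓑
  have _ : StarOrderedRing 𝓑 := CStarAlgebra.spectralOrderedRing 𝓑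
  -- The net is indexed by itself: the positive elements of the open unit ball are directed.
  let Λ := {x : 𝓑 // x ∈ {x : 𝓑 | 0 ≤ x} ∩ Metric.ball 0 1}
  have hnorm : ∀ l : Λ, ‖l.1‖ ≤ 1 := fun l => (mem_ball_zero_iff.mp l.2.2).le
  refine ⟨Λ, inferInstance, directedOn_iff_isDirectedOrder.mp CStarAlgebra.directedOn_nonneg_ball,
    ⟨⟨0, by simp⟩⟩, fun l => l.1, fun l l' h => ?_, fun l => ?_, hnorm, fun b => ?_⟩
  · exact CStarAlgebra.nonneg_iff_eq_star_mul_self.mp (sub_nonneg.mpr h)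
  · exact CStarAlgebra.nonneg_iff_eq_star_mul_self.mp l.2.1
  · refine ((CStarAlgebra.increasingApproximateUnit 𝓑).tendsto_mul_right b).comp ?_
    rw [(CStarAlgebra.hasBasis_approximateUnit 𝓑).tendsto_right_iff]
    intro x hx
    filter_upwards [eventually_ge_atTop (⟨x, by simpa using hx⟩ : Λ)] with l hl
    exact ⟨hl, by simpa using hnorm l⟩

variable [PartialOrder 𝓜] [StarOrderedRing 𝓜]

/-- If `A` is densely spanned by elements `n` with `n n⋆ ∈ B`, then an approximate unit of the
C*-algebra `B` is one of `A`. -/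
theorem containsApproximateUnit_of_mul_star_mem {B A : NonUnitalStarSubalgebra ℂ 𝓜}
    (hB : IsClosed (B : Set 𝓜)) {S : Set 𝓜}
    (hAS : ∀ x ∈ A, x ∈ closure (Submodule.span ℂ S : Set 𝓜))
    (hS : ∀ n ∈ S, n * star n ∈ B) : ContainsApproximateUnit B A := by
  -- Closedness is needed as an instance: it makes `B` a C⋆-algebra.
  have _ := hB
  obtain ⟨Λ, _, hdir, hne, e, hmono, hpos, hnorm, hlim⟩ := exists_increasing_net B
  have he0 : ∀ l, 0 ≤ (e l : 𝓜) := fun l => by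
    obtain ⟨y, hy⟩ := hpos l
    rw [hy]
    exact star_mul_self_nonneg (y : 𝓜)
  have hstar : ∀ l, star (e l : 𝓜) = e l := fun l => (IsSelfAdjoint.of_nonneg (he0 l)).star_eq
  have hleft : ∀ x ∈ A, Tendsto (fun l => (e l : 𝓜) * x) atTop (𝓝 x) := fun x hx =>
    tendsto_mul_of_mem_closure_span (e := fun l => (e l : 𝓜)) (S := S) hnorm
      (fun n hn => tendsto_mul_of_tendsto_mul_mul_star hstar hnorm
        ((continuous_subtype_val.tendsto _).comp (hlim ⟨_, hS n hn⟩))) (hAS x hx)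
  refine ⟨Λ, inferInstance, hdir, hne, fun l => e l, fun l l' hl => ?_,
    fun l => ⟨(e l).2, he0 l, hnorm l⟩, fun x hx => ⟨hleft x hx, ?_⟩⟩
  · obtain ⟨y, hy⟩ := hmono l l' hl
    have h1 : (e l' : 𝓜) - e l = star (y : 𝓜) * y := congrArg Subtype.val hy
    rw [← sub_nonneg, h1]
    exact star_mul_self_nonneg _
  -- Right multiplication is the adjoint of left multiplication, and A is self-adjoint.
  · simpa [star_mul, hstar] using (hleft _ (star_mem hx)).star

end ApproximateUnit

namespace CoarseModule

variable {X : Type u} [CoarseSpace X] {H : Type v} [NormedAddCommGroup H]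
  [InnerProductSpace ℂ H] [CompleteSpace H] (M : CoarseModule X H) {I : Type w} {a : I → M.meas}

/-! ### Block calculus -/

lemma χ_mul_of_disjoint {A B : M.meas} (h : Disjoint (A : Set X) (B : Set X)) :
    M.χ A * M.χ B = 0 :=
  ContinuousLinearMap.ext fun v => M.χ_apply_disjoint h v

lemma χ_mul_of_subset {A B : M.meas} (h : (A : Set X) ⊆ B) : M.χ A * M.χ B = M.χ A := by
  rw [← M.χ_inf]
  exact congrArg M.χ (Subtype.ext (Set.inter_eq_left.mpr h))

variable {M}

namespace IsDiscretePartition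

lemma χ_mul_of_ne (ha : M.IsDiscretePartition a) {i j : I} (h : i ≠ j) :
    M.χ (a i) * M.χ (a j) = 0 :=
  M.χ_mul_of_disjoint (ha.partition.1 i j h)

/-- With `ext_left` and `mul_eq_zero` this replaces infinite matrix calculus: as the projections sum
strongly to 1, identities can be checked one block column, block row or inner index at a time. -/
lemma ext_right (ha : M.IsDiscretePartition a) {s t : H →L[ℂ] H}
    (h : ∀ i, s * M.χ (a i) = t * M.χ (a i)) : s = t := by
  ext v
  refine ((ha.hasSum v).mapL s).unique ?_
  convert (ha.hasSum v).mapL t using 2 with i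
  exact DFunLike.congr_fun (h i) v

lemma ext_left (ha : M.IsDiscretePartition a) {s t : H →L[ℂ] H}
    (h : ∀ i, M.χ (a i) * s = M.χ (a i) * t) : s = t := by
  ext v
  refine (ha.hasSum (s v)).unique ?_
  convert ha.hasSum (t v) using 2 with i
  exact DFunLike.congr_fun (h i) v

lemma mul_eq_zero (ha : M.IsDiscretePartition a) {s t : H →L[ℂ] H}
    (h : ∀ i, s * M.χ (a i) * t = 0) : s * t = 0 := by
  ext v
  refine ((ha.hasSum (t v)).mapL s).unique ?_
  have h1 : (fun i => s (M.χ (a i) (t v))) = fun _ => 0 :=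
    funext fun i => DFunLike.congr_fun (h i) v
  rw [h1]
  exact hasSum_zero

lemma mem_prodBounded_iff (ha : M.IsDiscretePartition a) {t : H →L[ℂ] H} :
    t ∈ M.prodBounded a ↔ ∀ i j, i ≠ j → M.χ (a i) * t * M.χ (a j) = 0 := by
  refine ⟨fun h i j hij => ?_, fun h i => ?_⟩
  · have h1 : M.χ (a i) * t = t * M.χ (a i) := h i
    rw [h1, mul_assoc, ha.χ_mul_of_ne hij, mul_zero]
  · have h1 : M.χ (a i) * t = M.χ (a i) * t * M.χ (a i) := ha.ext_right fun j => by
      rcases eq_or_ne i j with rfl | hij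
      · rw [mul_assoc (M.χ (a i) * t), M.χ_mul_self]
      · rw [mul_assoc (M.χ (a i) * t), ha.χ_mul_of_ne hij, mul_zero, h i j hij]
    have h2 : t * M.χ (a i) = M.χ (a i) * t * M.χ (a i) := ha.ext_left fun j => by
      rcases eq_or_ne i j with rfl | hij
      · rw [← mul_assoc, ← mul_assoc, ← mul_assoc, M.χ_mul_self]
      · rw [← mul_assoc, ← mul_assoc, ← mul_assoc, ha.χ_mul_of_ne hij.symm, zero_mul, zero_mul,
          h j i hij.symm]
    rw [h1, ← h2]

/-! ### The conditional expectation -/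

/-- This and `χ_mul_condExp` determine the expectation, so its linearity and bimodule properties
follow without returning to the series. -/
lemma condExp_mul_χ (ha : M.IsDiscretePartition a) (t : H →L[ℂ] H) (i : I) :
    M.condExp ha t * M.χ (a i) = M.χ (a i) * t * M.χ (a i) := by
  ext v
  refine (M.hasSum_condExp ha t (M.χ (a i) v)).unique ?_
  have h1 : (M.χ (a i) * t * M.χ (a i)) v = M.χ (a i) (t (M.χ (a i) (M.χ (a i) v))) := by
    rw [M.χ_apply_self]; rfl
  rw [h1]
  refine hasSum_single i fun j hj => ?_
  rw [M.χ_apply_disjoint (ha.partition.1 j i hj), map_zero, map_zero]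

lemma χ_mul_condExp (ha : M.IsDiscretePartition a) (t : H →L[ℂ] H) (i : I) :
    M.χ (a i) * M.condExp ha t = M.χ (a i) * t * M.χ (a i) := by
  ext v
  refine ((M.hasSum_condExp ha t v).mapL (M.χ (a i))).unique ?_
  have h1 : (M.χ (a i) * t * M.χ (a i)) v = M.χ (a i) (M.χ (a i) (t (M.χ (a i) v))) := by
    rw [M.χ_apply_self]; rfl
  rw [h1]
  refine hasSum_single i fun j hj => ?_
  rw [M.χ_apply_disjoint (ha.partition.1 i j hj.symm)]

lemma condExp_mem_prodBounded (ha : M.IsDiscretePartition a) (t : H →L[ℂ] H) :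
    M.condExp ha t ∈ M.prodBounded a := fun i => by
  rw [ha.χ_mul_condExp, ha.condExp_mul_χ]

lemma condExp_mem_prodCompact (ha : M.IsDiscretePartition a) {t : H →L[ℂ] H}
    (ht : ∀ i, IsCompactOperator (M.χ (a i) * t * M.χ (a i))) :
    M.condExp ha t ∈ M.prodCompact a :=
  ⟨ha.condExp_mem_prodBounded t, fun i => by
    rw [ha.χ_mul_condExp, mul_assoc _ _ (M.χ (a i)), M.χ_mul_self]
    exact ht i⟩

lemma condExp_of_mem (ha : M.IsDiscretePartition a) {t : H →L[ℂ] H} (ht : t ∈ M.prodBounded a) :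
    M.condExp ha t = t := ha.ext_right fun i => by
  have h1 : M.χ (a i) * t = t * M.χ (a i) := ht i
  rw [ha.condExp_mul_χ, h1, mul_assoc, M.χ_mul_self]

lemma norm_condExp_le (ha : M.IsDiscretePartition a) (t : H →L[ℂ] H) :
    ‖M.condExp ha t‖ ≤ ‖t‖ :=
  LinearMap.mkContinuous_norm_le _ (norm_nonneg t) _

lemma condExp_add (ha : M.IsDiscretePartition a) (s t : H →L[ℂ] H) :
    M.condExp ha (s + t) = M.condExp ha s + M.condExp ha t := ha.ext_right fun i => by
  simp only [add_mul, mul_add, ha.condExp_mul_χ]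

lemma condExp_smul (ha : M.IsDiscretePartition a) (c : ℂ) (t : H →L[ℂ] H) :
    M.condExp ha (c • t) = c • M.condExp ha t := ha.ext_right fun i => by
  simp only [smul_mul_assoc, mul_smul_comm, ha.condExp_mul_χ]

lemma condExp_mul_left (ha : M.IsDiscretePartition a) {b : H →L[ℂ] H} (hb : b ∈ M.prodBounded a)
    (t : H →L[ℂ] H) : M.condExp ha (b * t) = b * M.condExp ha t := ha.ext_right fun i => by
  have h1 : M.χ (a i) * b = b * M.χ (a i) := hb i
  rw [mul_assoc, ha.condExp_mul_χ, ha.condExp_mul_χ, ← mul_assoc, h1]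
  simp only [mul_assoc]

lemma condExp_mul_right (ha : M.IsDiscretePartition a) {b : H →L[ℂ] H}
    (hb : b ∈ M.prodBounded a) (t : H →L[ℂ] H) :
    M.condExp ha (t * b) = M.condExp ha t * b := ha.ext_left fun i => by
  have h1 : M.χ (a i) * b = b * M.χ (a i) := hb i
  rw [← mul_assoc (M.χ (a i)) (M.condExp ha t), ha.χ_mul_condExp, ha.χ_mul_condExp,
    mul_assoc _ _ b, h1]
  simp only [mul_assoc]

/-- Positivity of the expectation is read off from this series of non-negative terms. -/
lemma inner_condExp_star_mul_self (ha : M.IsDiscretePartition a) (t : H →L[ℂ] H) (v : H) :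
    HasSum (fun i => ((‖t (M.χ (a i) v)‖ ^ 2 : ℝ) : ℂ))
      (inner ℂ v (M.condExp ha (star t * t) v)) := by
  have h := (M.hasSum_condExp ha (star t * t) v).mapL (innerSL ℂ v)
  rw [innerSL_apply_apply] at h
  convert! h using 1
  funext i
  rw [innerSL_apply_apply, ← M.inner_χ, mul_apply_eq_comp,
    ContinuousLinearMap.star_eq_adjoint, ContinuousLinearMap.adjoint_inner_right,
    inner_self_eq_norm_sq_to_K]
  push_cast
  rfl

lemma condExp_star_mul_self_nonneg (ha : M.IsDiscretePartition a) (t : H →L[ℂ] H) :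
    0 ≤ M.condExp ha (star t * t) := by
  rw [ContinuousLinearMap.nonneg_iff_isPositive, ContinuousLinearMap.isPositive_iff_complex]
  intro v
  obtain ⟨r, hr0, hr⟩ : ∃ r : ℝ, 0 ≤ r ∧ inner ℂ v (M.condExp ha (star t * t) v) = r := by
    have h := ha.inner_condExp_star_mul_self t v
    have h1 : HasSum (fun i => ‖t (M.χ (a i) v)‖ ^ 2)
        (inner ℂ v (M.condExp ha (star t * t) v)).re := by
      simpa only [Complex.ofReal_re] using Complex.hasSum_re h
    exact ⟨_, h1.nonneg fun i => by positivity, h.unique (Complex.hasSum_ofReal.mpr h1)⟩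
  have h2 : inner ℂ (M.condExp ha (star t * t) v) v = (r : ℂ) := by
    rw [← inner_conj_symm, hr, Complex.conj_ofReal]
  rw [h2]
  simpa using hr0

/-- The i-th diagonal block of t⋆t is (tχ_i)⋆(tχ_i), so the C⋆-identity kills every block column of
t. -/
lemma eq_zero_of_condExp_star_mul_self (ha : M.IsDiscretePartition a) {t : H →L[ℂ] H}
    (h : M.condExp ha (star t * t) = 0) : t = 0 := ha.ext_right fun i => by
  have h1 := ha.condExp_mul_χ (star t * t) i
  rw [h, zero_mul] at h1
  rw [zero_mul, ← CStarRing.star_mul_self_eq_zero_iff, star_mul, M.χ_star, h1]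
  simp only [mul_assoc]

end IsDiscretePartition

/-! ### Operators with at most one block in every row and column -/

variable (M a) in
/-- The operator `n` has at most one non-zero block `χ_{A i} n χ_{A j}` in every row and column. -/
def IsBlockMatching (n : H →L[ℂ] H) : Prop :=
  (∀ k i j, i ≠ j → M.χ (a i) * n * M.χ (a k) = 0 ∨ M.χ (a j) * n * M.χ (a k) = 0) ∧
    ∀ k i j, i ≠ j → M.χ (a k) * n * M.χ (a i) = 0 ∨ M.χ (a k) * n * M.χ (a j) = 0

lemma block_star_eq_zero {n : H →L[ℂ] H} {i j : I} (h : M.χ (a i) * n * M.χ (a j) = 0) :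
    M.χ (a j) * star n * M.χ (a i) = 0 := by
  simpa [M.χ_star, mul_assoc] using congrArg star h

lemma IsBlockMatching.star {n : H →L[ℂ] H} (hn : M.IsBlockMatching a n) :
    M.IsBlockMatching a (star n) :=
  ⟨fun k i j hij => (hn.2 k i j hij).imp block_star_eq_zero block_star_eq_zero,
    fun k i j hij => (hn.1 k i j hij).imp block_star_eq_zero block_star_eq_zero⟩

/-- The (i, j) block is a sum over k of n_ik b_k (n_jk)⋆, and for i ≠ j one of n_ik, n_jk is zero
since they lie in the same column. -/
lemma IsBlockMatching.conj_mem_prodBounded (ha : M.IsDiscretePartition a) {n b : H →L[ℂ] H}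
    (hn : M.IsBlockMatching a n) (hb : b ∈ M.prodBounded a) :
    n * b * Star.star n ∈ M.prodBounded a := by
  rw [ha.mem_prodBounded_iff]
  intro i j hij
  have h : (M.χ (a i) * n * b) * (Star.star n * M.χ (a j)) = 0 := ha.mul_eq_zero fun k => by
    have hk : M.χ (a k) * b = b * M.χ (a k) := hb k
    rcases hn.1 k i j hij with h0 | h0
    · rw [mul_assoc _ b, ← hk, ← mul_assoc (M.χ (a i) * n), h0, zero_mul, zero_mul]
    · have h1 := block_star_eq_zero h0
      rw [mul_assoc _ (M.χ (a k)), ← mul_assoc (M.χ (a k)), h1, mul_zero]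
  simpa only [mul_assoc] using h

/-! ### Cutting operators of controlled propagation by colour classes. -/

/-- If G bounds the blocks, then K ∘ G ∘ K⁻¹ bounds all the sets K(A_i) at once, so one N serves
every i. -/
lemma exists_encard_relImage_le (ha : M.IsDiscretePartition a)
    (hulf : IsUniformlyLocallyFinite fun i => (a i : Set X)) {K : Set (X × X)}
    (hK : CoarseSpace.IsControlled K) :
    ∃ N : ℕ, ∀ i, {j | ((a j : Set X) ∩ relImage K (a i : Set X)).Nonempty}.encard ≤ N := by
  obtain ⟨G, hG, hGa⟩ := ha.controlled
  obtain ⟨N, hN⟩ := hulf _ (CoarseSpace.controlled_comp hK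
    (CoarseSpace.controlled_comp hG.1 (CoarseSpace.controlled_op hK)))
  refine ⟨N, fun i => hN _ ?_⟩
  rintro ⟨y, y'⟩ ⟨⟨x, hx, hyx⟩, ⟨x', hx', hyx'⟩⟩
  exact ⟨x, hyx, x', hGa i ⟨hx, hx'⟩, hyx'⟩

/-- The measurable union of a subfamily of a discrete partition. -/
lemma exists_meas_eq_iUnion (ha : M.IsDiscretePartition a) (S : Set I) :
    ∃ P : M.meas, (∀ i ∈ S, M.χ P * M.χ (a i) = M.χ (a i)) ∧
      ∀ i, i ∉ S → M.χ P * M.χ (a i) = 0 := by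
  have hinter : ∀ i, i ∉ S → Disjoint (⋃ j ∈ S, (a j : Set X)) (a i : Set X) := fun i hi => by
    simp only [Set.disjoint_iUnion_left]
    exact fun j hj => ha.partition.1 j i fun h => hi (h ▸ hj)
  have hsub : ∀ i ∈ S, (a i : Set X) ⊆ ⋃ j ∈ S, (a j : Set X) := fun i hi =>
    Set.subset_biUnion_of_mem (u := fun j => (a j : Set X)) hi
  -- Measurable sets form only a Boolean algebra; this possibly infinite union is measurable because
  -- the partition detects measurability.
  have hP : (⋃ j ∈ S, (a j : Set X)) ∈ M.meas := ha.mem_of_inter_mem _ fun i => by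
    by_cases hi : i ∈ S
    · rw [Set.inter_eq_right.mpr (hsub i hi)]
      exact (a i).2
    · rw [Set.disjoint_iff_inter_eq_empty.mp (hinter i hi)]
      exact M.meas.bot_mem
  refine ⟨⟨_, hP⟩, fun i hi => ?_, fun i hi => M.χ_mul_of_disjoint (hinter i hi)⟩
  rw [M.χ_comm]
  exact M.χ_mul_of_subset (hsub i hi)

/-- An operator of controlled propagation is cut by finitely many measurable sets into pieces with
at most one block in every row and column. -/
theorem exists_block_matching_decomposition (ha : M.IsDiscretePartition a)
    (hulf : IsUniformlyLocallyFinite fun i => (a i : Set X)) {t : H →L[ℂ] H}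
    (ht : M.HasControlledPropagation t) :
    ∃ (m : ℕ) (P : Fin m → M.meas), ∑ c, M.χ (P c) = 1 ∧
      ∀ c d, M.IsBlockMatching a (M.χ (P c) * t * M.χ (P d)) := by
  obtain ⟨E, hE, hsupp⟩ := ht
  obtain ⟨G, hG, hGa⟩ := ha.controlled
  -- Row indices of two non-zero blocks in one column are linked by E ∘ G ∘ E⁻¹, column indices of
  -- two in one row by E⁻¹ ∘ G ∘ E. Using E ∪ E⁻¹ covers both cases, and adding the transpose makes
  -- the relation visibly symmetric.
  have hE' := CoarseSpace.controlled_op hE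
  have hEE := CoarseSpace.controlled_union hE hE'
  have hK₀ := CoarseSpace.controlled_comp hEE (CoarseSpace.controlled_comp hG.1 hEE)
  have hK := CoarseSpace.controlled_union hK₀ (CoarseSpace.controlled_op hK₀)
  set K₀ : Set (X × X) := {p | ∃ y, (p.1, y) ∈ E ∪ {p | (p.2, p.1) ∈ E} ∧
    (y, p.2) ∈ {p : X × X | ∃ y, (p.1, y) ∈ G ∧ (y, p.2) ∈ E ∪ {p | (p.2, p.1) ∈ E}}}
  obtain ⟨N, hN⟩ := exists_encard_relImage_le ha hulf hK
  set K := K₀ ∪ {p | (p.2, p.1) ∈ K₀}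
  obtain ⟨c, hc⟩ := exists_finite_coloring
    (fun i j => ((a j : Set X) ∩ relImage K (a i : Set X)).Nonempty)
    (by
      rintro i j ⟨y, hy, x, hx, hyx⟩
      exact ⟨x, hx, y, hy, hyx.symm⟩) N hN
  have hblock : ∀ i k, M.χ (a i) * t * M.χ (a k) ≠ 0 →
      ∃ y ∈ (a i : Set X), ∃ x ∈ (a k : Set X), (y, x) ∈ E := by
    intro i k hik
    obtain ⟨y, hy, x, hx, hyx⟩ := Set.nonempty_iff_ne_empty.mpr (mt (hsupp (a i) (a k)) hik)
    exact ⟨y, hy, x, hx, hyx⟩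
  choose P hP hP' using fun k : Fin (N + 1) => exists_meas_eq_iUnion ha {i | c i = k}
  -- A block that survives the cut has row colour k and column colour l, and is a block of t.
  have hcut : ∀ (k l : Fin (N + 1)) (i j : I),
      M.χ (a i) * (M.χ (P k) * t * M.χ (P l)) * M.χ (a j) ≠ 0 →
      c i = k ∧ c j = l ∧ M.χ (a i) * t * M.χ (a j) ≠ 0 := by
    intro k l i j h
    have h1 : M.χ (a i) * (M.χ (P k) * t * M.χ (P l)) * M.χ (a j)
        = (M.χ (P k) * M.χ (a i)) * t * (M.χ (P l) * M.χ (a j)) := by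
      rw [M.χ_comm (P k)]; simp only [mul_assoc]
    rw [h1] at h
    have hi : c i = k := by
      by_contra hne
      exact h (by rw [hP' k i hne, zero_mul, zero_mul])
    have hj : c j = l := by
      by_contra hne
      exact h (by rw [hP' l j hne, mul_zero])
    rw [hP k i hi, hP l j hj] at h
    exact ⟨hi, hj, h⟩
  refine ⟨N + 1, P, ha.ext_right fun i => ?_, fun k l => ⟨fun m i j hij => ?_, fun m i j hij => ?_⟩⟩
  · rw [Finset.sum_mul, one_mul, Finset.sum_eq_single (c i), hP _ i rfl]
    · exact fun k _ hk => hP' k i (Ne.symm hk)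
    · exact fun h => absurd (Finset.mem_univ _) h
  -- Two surviving blocks in column m would have related distinct row indices of the same colour k.
  -- The next case does the same for rows.
  · by_contra! hne
    obtain ⟨hi, -, h1⟩ := hcut k l i m hne.1
    obtain ⟨hj, -, h2⟩ := hcut k l j m hne.2
    obtain ⟨y, hy, x, hx, hyx⟩ := hblock i m h1
    obtain ⟨y', hy', x', hx', hyx'⟩ := hblock j m h2
    refine hc i j ⟨y', hy', y, hy, Or.inl ⟨x', Or.inl hyx', x, hGa m ⟨hx', hx⟩, Or.inr hyx⟩⟩ hij ?_
    rw [hi, hj]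
  · by_contra! hne
    obtain ⟨-, hi, h1⟩ := hcut k l m i hne.1
    obtain ⟨-, hj, h2⟩ := hcut k l m j hne.2
    obtain ⟨y, hy, x, hx, hyx⟩ := hblock m i h1
    obtain ⟨y', hy', x', hx', hyx'⟩ := hblock m j h2
    refine hc i j ⟨x', hx', x, hx, Or.inl ⟨y', Or.inr hyx', y, hGa m ⟨hy', hy⟩, Or.inl hyx⟩⟩ hij ?_
    rw [hi, hj]

end CoarseModule

/-! ### Virtual commutants and finite sums of compact operators. -/

/-- Bimodularity gives b φ(x) c = φ(b x c). No continuity of φ enters. -/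
theorem IsVirtualCommutant.mul_map_mul_eq_zero {𝓜 : Type v} [NonUnitalCStarAlgebra 𝓜]
    {B A : NonUnitalStarSubalgebra ℂ 𝓜} {J : Submodule ℂ 𝓜}
    {φ : J →ₗ[ℂ] A} (h : IsVirtualCommutant B A J φ) {b c : 𝓜} (hb : b ∈ B) (hc : c ∈ B) (x : J)
    (hx : b * x * c = 0) : b * φ x * c = 0 := by
  rw [← h.map_mul_left b hb x, ← h.map_mul_right ⟨b * x, _⟩ c hc]
  have h1 : (⟨b * x * c, h.mul_mem_right _ (h.mul_mem_left b hb x x.2) c hc⟩ : J) = 0 :=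
    Subtype.ext hx
  rw [h1, map_zero]
  rfl

lemma isCompactOperator_sum {H : Type v} [NormedAddCommGroup H] [InnerProductSpace ℂ H]
    {ι : Type*} (s : Finset ι) {f : ι → H →L[ℂ] H}
    (hf : ∀ i ∈ s, IsCompactOperator (f i)) : IsCompactOperator (∑ i ∈ s, f i : H →L[ℂ] H) :=
  Submodule.sum_mem (compactOperator (RingHom.id ℂ) H H) hf

namespace CoarseModule

variable {X : Type u} [CoarseSpace X] {H : Type v} [NormedAddCommGroup H]
  [InnerProductSpace ℂ H] [CompleteSpace H] {M : CoarseModule X H} {I : Type w} {a : I → M.meas}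

/-! ### The block-diagonal algebras -/

lemma χ_mem_prodBounded (C : M.meas) : M.χ C ∈ M.prodBounded a := fun i => M.χ_comm (a i) C

lemma prodCompact_le_prodBounded : M.prodCompact a ≤ M.prodBounded a := fun _ ht => ht.1

lemma isClosed_prodBounded : IsClosed (M.prodBounded a : Set (H →L[ℂ] H)) := by
  have h : (M.prodBounded a : Set (H →L[ℂ] H)) = ⋂ i, {t | M.χ (a i) * t = t * M.χ (a i)} := by
    ext t
    rw [Set.mem_iInter]
    rfl
  rw [h]
  exact isClosed_iInter fun i => isClosed_eq (by fun_prop) (by fun_prop)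

lemma isClosed_setOf_isCompactOperator_conj (s r : H →L[ℂ] H) :
    IsClosed {t : H →L[ℂ] H | IsCompactOperator (s * t * r)} :=
  isClosed_setOfPred_isCompactOperator.preimage
    (by fun_prop : Continuous fun t : H →L[ℂ] H => s * t * r)

lemma isClosed_prodCompact : IsClosed (M.prodCompact a : Set (H →L[ℂ] H)) := by
  have h : (M.prodCompact a : Set (H →L[ℂ] H)) = (M.prodBounded a : Set (H →L[ℂ] H)) ∩
      ⋂ i, {t | IsCompactOperator (M.χ (a i) * t * M.χ (a i))} := by
    ext t
    rw [Set.mem_inter_iff, Set.mem_iInter]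
    rfl
  rw [h]
  exact isClosed_prodBounded.inter
    (isClosed_iInter fun i => isClosed_setOf_isCompactOperator_conj _ _)

/-- Block-diagonal operators propagate only inside blocks: if a block meets both B and A, the gauge
bounding the blocks relates a point of B to a point of A. -/
lemma prodBounded_le_cpStar (ha : M.IsDiscretePartition a) : M.prodBounded a ≤ M.cpStar := by
  intro t ht
  obtain ⟨G, hG, hGa⟩ := ha.controlled
  refine ⟨G, hG.1, fun B A hBA => ha.mul_eq_zero fun i => ?_⟩
  have hi : M.χ (a i) * t = t * M.χ (a i) := ht i
  have hdisj : Disjoint (B : Set X) (a i) ∨ Disjoint (a i : Set X) A := by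
    by_contra! h
    obtain ⟨y, hyB, hya⟩ := Set.not_disjoint_iff.mp h.1
    obtain ⟨x, hxa, hxA⟩ := Set.not_disjoint_iff.mp h.2
    exact Set.eq_empty_iff_forall_notMem.mp hBA y ⟨hyB, x, hxA, hGa i ⟨hya, hxa⟩⟩
  rcases hdisj with h | h
  · rw [mul_assoc (M.χ B), ← hi, ← mul_assoc, M.χ_mul_of_disjoint h, zero_mul, zero_mul]
  · rw [mul_assoc _ (M.χ (a i)), M.χ_mul_of_disjoint h, mul_zero]

lemma isBounded_of_isDiscretePartition (ha : M.IsDiscretePartition a) (i : I) :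
    IsBounded (a i : Set X) := by
  obtain ⟨G, hG, hGa⟩ := ha.controlled
  exact CoarseSpace.controlled_mono (hGa i) hG.1

/-- A bounded measurable set is covered by finitely many members of the partition. -/
lemma exists_finset_χ_eq_sum (ha : M.IsDiscretePartition a)
    (hulf : IsUniformlyLocallyFinite fun i => (a i : Set X)) {A : M.meas}
    (hA : IsBounded (A : Set X)) : ∃ s : Finset I, M.χ A = ∑ i ∈ s, M.χ A * M.χ (a i) := by
  classical
  obtain ⟨N, hN⟩ := hulf _ hA
  have hfin : {i | ((a i : Set X) ∩ A).Nonempty}.Finite :=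
    Set.finite_of_encard_le_coe (hN A subset_rfl)
  refine ⟨hfin.toFinset, ha.ext_right fun j => ?_⟩
  rw [Finset.sum_mul]
  by_cases hj : j ∈ hfin.toFinset
  · rw [Finset.sum_eq_single_of_mem j hj, mul_assoc, M.χ_mul_self]
    intro i _ hij
    rw [mul_assoc, ha.χ_mul_of_ne hij, mul_zero]
  · have hdisj : Disjoint (A : Set X) (a j) := by
      rw [Set.Finite.mem_toFinset, Set.mem_ofPred_eq, Set.not_nonempty_iff_eq_empty] at hj
      exact (Set.disjoint_iff_inter_eq_empty.mpr hj).symm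
    rw [M.χ_mul_of_disjoint hdisj, Finset.sum_eq_zero]
    intro i hi
    rw [mul_assoc, ha.χ_mul_of_ne (ne_of_mem_of_not_mem hi hj), mul_zero]

/-- A bounded set meets finitely many blocks, so χ_A t is a finite sum of compact operators; the
other side follows by taking adjoints. -/
lemma prodCompact_le_roeStar (ha : M.IsDiscretePartition a)
    (hulf : IsUniformlyLocallyFinite fun i => (a i : Set X)) : M.prodCompact a ≤ M.roeStar := by
  have key : ∀ t ∈ M.prodCompact a, ∀ A : M.meas, IsBounded (A : Set X) →
      IsCompactOperator (M.χ A * t) := by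
    intro t ht A hA
    obtain ⟨s, hs⟩ := exists_finset_χ_eq_sum ha hulf hA
    rw [hs, Finset.sum_mul]
    refine isCompactOperator_sum s fun i _ => ?_
    have h1 : M.χ (a i) * t = t * M.χ (a i) := ht.1 i
    have h2 : M.χ A * M.χ (a i) * t = M.χ A * (M.χ (a i) * t * M.χ (a i)) := by
      rw [h1, mul_assoc t, M.χ_mul_self, mul_assoc, h1]
    rw [h2]
    exact (ht.2 i).clm_comp _
  refine fun t ht => ⟨prodBounded_le_cpStar ha ht.1, fun A hA => ⟨key t ht A hA, ?_⟩⟩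
  have h : IsCompactOperator (star (M.χ A * star t) : H →L[ℂ] H) :=
    isCompactOperator_star (key _ (star_mem ht) A hA)
  rwa [star_mul, star_star, M.χ_star] at h

lemma isCompactOperator_block_of_mem_roeCStar (ha : M.IsDiscretePartition a) {t : H →L[ℂ] H}
    (ht : t ∈ M.roeCStar) (i : I) : IsCompactOperator (M.χ (a i) * t * M.χ (a i)) := by
  refine closure_minimal (fun s hs => ?_) (isClosed_setOf_isCompactOperator_conj _ _) ht
  exact (hs.2 _ (isBounded_of_isDiscretePartition ha i)).1.comp_clm _

lemma χ_mul_mul_χ_mem_cpStar (ha : M.IsDiscretePartition a) {t : H →L[ℂ] H} (ht : t ∈ M.cpStar)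
    (C D : M.meas) : M.χ C * t * M.χ D ∈ M.cpStar :=
  mul_mem (mul_mem (prodBounded_le_cpStar ha (χ_mem_prodBounded C)) ht)
    (prodBounded_le_cpStar ha (χ_mem_prodBounded D))

/-- The χ_C need not be locally compact, but they multiply the Roe ⋆-algebra because they commute
with every χ_A. -/
lemma χ_mul_mul_χ_mem_roeStar (ha : M.IsDiscretePartition a) {t : H →L[ℂ] H} (ht : t ∈ M.roeStar)
    (C D : M.meas) : M.χ C * t * M.χ D ∈ M.roeStar := by
  refine ⟨χ_mul_mul_χ_mem_cpStar ha ht.1 C D, fun A hA => ⟨?_, ?_⟩⟩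
  · have h : M.χ A * (M.χ C * t * M.χ D) = M.χ C * ((M.χ A * t) * M.χ D) := by
      rw [mul_assoc (M.χ C), ← mul_assoc, M.χ_comm]; simp only [mul_assoc]
    rw [h]
    exact ((ht.2 A hA).1.comp_clm _).clm_comp _
  · have h : M.χ C * t * M.χ D * M.χ A = M.χ C * ((t * M.χ A) * M.χ D) := by
      rw [mul_assoc, M.χ_comm]; simp only [mul_assoc]
    rw [h]
    exact ((ht.2 A hA).2.comp_clm _).clm_comp _

/-- Compactness of the blocks comes from n alone, so b may be any bounded block-diagonal operator,
in particular 1. -/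
lemma IsBlockMatching.conj_mem_prodCompact (ha : M.IsDiscretePartition a) {n b : H →L[ℂ] H}
    (hn : M.IsBlockMatching a n) (hn' : n ∈ M.roeStar) (hb : b ∈ M.prodBounded a) :
    n * b * Star.star n ∈ M.prodCompact a :=
  ⟨hn.conj_mem_prodBounded ha hb, fun i => by
    have h : M.χ (a i) * (n * b * Star.star n) * M.χ (a i)
        = M.χ (a i) * n * (b * Star.star n * M.χ (a i)) := by simp only [mul_assoc]
    rw [h]
    exact (hn'.2 _ (isBounded_of_isDiscretePartition ha i)).1.comp_clm _⟩

/-! ### Cartan subalgebras -/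

lemma mem_span_isBlockMatching (ha : M.IsDiscretePartition a)
    (hulf : IsUniformlyLocallyFinite fun i => (a i : Set X))
    {K : NonUnitalStarSubalgebra ℂ (H →L[ℂ] H)} (hK : K ≤ M.cpStar)
    (hχ : ∀ t ∈ K, ∀ C D : M.meas, M.χ C * t * M.χ D ∈ K) {t : H →L[ℂ] H} (ht : t ∈ K) :
    t ∈ Submodule.span ℂ {n | n ∈ K ∧ M.IsBlockMatching a n} := by
  obtain ⟨m, P, hP, hPt⟩ := exists_block_matching_decomposition ha hulf (hK ht)
  have h : t = ∑ c, ∑ d, M.χ (P c) * t * M.χ (P d) := by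
    simp only [← Finset.mul_sum, ← Finset.sum_mul, hP, one_mul, mul_one]
  rw [h]
  exact sum_mem fun c _ => sum_mem fun d _ =>
    Submodule.subset_span ⟨hχ t ht (P c) (P d), hPt c d⟩

/-- The restriction of the block-diagonal part to an inclusion of algebras is a faithful conditional
expectation. -/
theorem exists_faithful_expectation (ha : M.IsDiscretePartition a)
    {B A : NonUnitalStarSubalgebra ℂ (H →L[ℂ] H)} (hB : B ≤ M.prodBounded a)
    (hE : ∀ x ∈ A, M.condExp ha x ∈ B) :
    ∃ E : A →ₗ[ℂ] B, IsConditionalExpectation B A E ∧ IsFaithfulMap B A E := by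
  refine ⟨{ toFun := fun x => ⟨M.condExp ha x, hE x x.2⟩
            map_add' := fun x y => Subtype.ext (ha.condExp_add x y)
            map_smul' := fun c x => Subtype.ext (ha.condExp_smul c x) }, ?_, fun x hx => ?_⟩
  · exact
      { map_of_mem := fun x hx => ha.condExp_of_mem (hB hx)
        positive := fun x => ha.condExp_star_mul_self_nonneg (x : H →L[ℂ] H)
        contractive := fun x => ha.norm_condExp_le x
        map_mul_left := fun b x hb => ha.condExp_mul_left (hB hb) x
        map_mul_right := fun x b hb => ha.condExp_mul_right (hB hb) x }
  · exact Subtype.ext (ha.eq_zero_of_condExp_star_mul_self (congrArg Subtype.val hx))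

/-- A criterion for a closed algebra `B` of block-diagonal operators to be a non-commutative Cartan
subalgebra of the closure of an algebra of operators of controlled propagation. -/
theorem isNCCartan_topologicalClosure (ha : M.IsDiscretePartition a)
    (hulf : IsUniformlyLocallyFinite fun i => (a i : Set X))
    {B K : NonUnitalStarSubalgebra ℂ (H →L[ℂ] H)} (hK : K ≤ M.cpStar)
    (hχ : ∀ t ∈ K, ∀ C D : M.meas, M.χ C * t * M.χ D ∈ K)
    (hBclosed : IsClosed (B : Set (H →L[ℂ] H))) (hBK : B ≤ K) (hB : B ≤ M.prodBounded a)
    (hE : ∀ x ∈ K.topologicalClosure, M.condExp ha x ∈ B)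
    (hconj : ∀ n ∈ K, M.IsBlockMatching a n → ∀ b ∈ M.prodBounded a, n * b * star n ∈ B)
    (hvc : ∀ (J : Submodule ℂ (H →L[ℂ] H)) (φ : J →ₗ[ℂ] K.topologicalClosure),
      IsVirtualCommutant B K.topologicalClosure J φ →
        ∀ x, (φ x : H →L[ℂ] H) ∈ M.prodBounded a) :
    IsNCCartan B K.topologicalClosure := by
  have hspan : ∀ x ∈ K.topologicalClosure,
      x ∈ closure (Submodule.span ℂ {n | n ∈ K ∧ M.IsBlockMatching a n} : Set (H →L[ℂ] H)) :=
    fun x hx => closure_mono (fun t ht => mem_span_isBlockMatching ha hulf hK hχ ht) hx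
  refine
    { isClosed_sub := hBclosed
      isClosed_alg := K.isClosed_topologicalClosure
      le := hBK.trans K.le_topologicalClosure
      image_virtual_commutant := fun J φ h x => ?_
      approximate_unit := containsApproximateUnit_of_mul_star_mem hBclosed hspan fun n hn => ?_
      generated := le_antisymm ?_ fun x hx => closure_mono ?_ (hspan x hx)
      faithful_expectation := exists_faithful_expectation ha hB hE }
  -- Being block-diagonal, φ(x) equals its own expectation, which lies in B since φ(x) lies in the
  -- closure of K.
  · rw [← ha.condExp_of_mem (hvc J φ h x)]
    exact hE _ (φ x).2
  -- Taking b = 1 gives n n⋆ ∈ B, even when 1 is not in B.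
  · have h1 : (1 : H →L[ℂ] H) ∈ M.prodBounded a := fun i => by rw [one_mul, mul_one]
    simpa using hconj n hn.1 hn.2 1 h1
  · exact NonUnitalStarSubalgebra.topologicalClosure_minimal _
      (NonUnitalStarAlgebra.adjoin_le fun n hn => hn.1) K.isClosed_topologicalClosure
  · have h1 : {n | n ∈ K ∧ M.IsBlockMatching a n} ⊆ normalizers B K.topologicalClosure :=
      fun n hn => ⟨K.le_topologicalClosure hn.1, fun b hb => ⟨hconj n hn.1 hn.2 b (hB hb), by
        simpa using hconj _ (star_mem hn.1) hn.2.star b (hB hb)⟩⟩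
    have h2 : Submodule.span ℂ {n | n ∈ K ∧ M.IsBlockMatching a n} ≤ (NonUnitalStarAlgebra.adjoin ℂ
        (normalizers B K.topologicalClosure)).toSubmodule :=
      Submodule.span_le.mpr (h1.trans (NonUnitalStarAlgebra.subset_adjoin ℂ _))
    exact h2

theorem isNCCartan_prodBounded (ha : M.IsDiscretePartition a)
    (hulf : IsUniformlyLocallyFinite fun i => (a i : Set X)) :
    IsNCCartan (M.prodBounded a) M.cpCStar :=
  isNCCartan_topologicalClosure ha hulf le_rfl (fun _ ht => χ_mul_mul_χ_mem_cpStar ha ht)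
    isClosed_prodBounded (prodBounded_le_cpStar ha) le_rfl
    (fun x _ => ha.condExp_mem_prodBounded x)
    (fun _ _ hn' _ hb => hn'.conj_mem_prodBounded ha hb)
    (fun _ _ h x => ha.mem_prodBounded_iff.mpr fun i j hij =>
      h.mul_map_mul_eq_zero (χ_mem_prodBounded _) (χ_mem_prodBounded _) x
        (ha.mem_prodBounded_iff.mp (h.le x x.2) i j hij))

/-! ### Virtual commutants in the Roe case and conclusion. -/

/-- These operators stand in for χ_i, which is not compact when the block is infinite-dimensional.
-/
lemma rankOne_mem_prodCompact (ha : M.IsDiscretePartition a) (i : I) {v : H}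
    (hv : M.χ (a i) v = v) : InnerProductSpace.rankOne ℂ v v ∈ M.prodCompact a := by
  refine ⟨fun j => ?_, fun j => ?_⟩
  · ext w
    change M.χ (a j) (inner ℂ v w • v) = inner ℂ v (M.χ (a j) w) • v
    rw [map_smul, ← M.inner_χ]
    rcases eq_or_ne j i with rfl | hij
    · rw [hv]
    · have h0 : M.χ (a j) v = 0 := by
        rw [← hv, M.χ_apply_disjoint (ha.partition.1 j i hij)]
      rw [h0, smul_zero, inner_zero_left, zero_smul]
  · have h : IsCompactOperator (InnerProductSpace.rankOne ℂ v v : H →L[ℂ] H) :=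
      (isCompactOperator_of_locallyCompactSpace_rng
        (ContinuousLinearMap.toSpanSingleton ℂ v)).comp_clm (innerSL ℂ v)
    exact (h.clm_comp (M.χ (a j))).comp_clm (M.χ (a j))

/-- An operator between different blocks vanishes if it is killed by rank-one projections. -/
lemma mem_prodBounded_of_forall_prodCompact (ha : M.IsDiscretePartition a) {x t : H →L[ℂ] H}
    (hx : x ∈ M.prodBounded a)
    (h : ∀ k ∈ M.prodCompact a, ∀ l ∈ M.prodCompact a, k * x * l = 0 → k * t * l = 0) :
    t ∈ M.prodBounded a := by
  rw [ha.mem_prodBounded_iff]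
  intro i j hij
  ext w
  set w' := M.χ (a j) w with hw'
  have hw : M.χ (a j) w' = w' := M.χ_apply_self _ _
  change M.χ (a i) (t w') = 0
  -- The test vector is the value to be shown zero: sandwiching t between the rank-one operators of
  -- v and w' and applying the result to w' gives ‖w'‖²‖v‖² v.
  set v := M.χ (a i) (t w') with hv'
  have hv : M.χ (a i) v = v := M.χ_apply_self _ _
  have hkxl : InnerProductSpace.rankOne ℂ v v * x * InnerProductSpace.rankOne ℂ w' w' = 0 := by
    ext z
    have h1 : M.χ (a i) (x w') = 0 :=
      DFunLike.congr_fun (ha.mem_prodBounded_iff.mp hx i j hij) w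
    have h2 : inner ℂ v (x w') = 0 := by rw [← hv, M.inner_χ, h1, inner_zero_right]
    change inner ℂ v (x (inner ℂ w' z • w')) • v = 0
    rw [map_smul, inner_smul_right, h2, mul_zero, zero_smul]
  have h3 := DFunLike.congr_fun (h _ (rankOne_mem_prodCompact ha i hv) _
    (rankOne_mem_prodCompact ha j hw) hkxl) w'
  have h4 : inner ℂ v (t w') = inner ℂ v v := by
    conv_lhs => rw [← hv]
    rw [M.inner_χ]
  change inner ℂ v (t (inner ℂ w' w' • w')) • v = 0 at h3
  rw [map_smul, inner_smul_right, h4, smul_eq_zero, mul_eq_zero, inner_self_eq_zero,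
    inner_self_eq_zero] at h3
  -- Either w' = 0, whence v = 0 by its definition, or v = 0 directly.
  rcases h3 with (h3 | h3) | h3
  · rw [hv', h3, map_zero, map_zero]
  · exact h3
  · exact h3

theorem isNCCartan_prodCompact (ha : M.IsDiscretePartition a)
    (hulf : IsUniformlyLocallyFinite fun i => (a i : Set X)) :
    IsNCCartan (M.prodCompact a) M.roeCStar :=
  isNCCartan_topologicalClosure ha hulf (fun _ ht => ht.1)
    (fun _ ht => χ_mul_mul_χ_mem_roeStar ha ht)
    isClosed_prodCompact (prodCompact_le_roeStar ha hulf) prodCompact_le_prodBounded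
    (fun _ hx => ha.condExp_mem_prodCompact (isCompactOperator_block_of_mem_roeCStar ha hx))
    (fun _ hn hn' _ hb => hn'.conj_mem_prodCompact ha hn hb)
    (fun _ _ h x => mem_prodBounded_of_forall_prodCompact ha (h.le x x.2).1
      fun _ hk _ hl => h.mul_map_mul_eq_zero hk hl x)

theorem condExp_image_eq (ha : M.IsDiscretePartition a)
    {B A : NonUnitalStarSubalgebra ℂ (H →L[ℂ] H)} (hB : B ≤ M.prodBounded a) (hBA : B ≤ A)
    (hE : ∀ x ∈ A, M.condExp ha x ∈ B) :
    (B : Set (H →L[ℂ] H)) = M.condExp ha '' (A : Set (H →L[ℂ] H)) :=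
  Set.Subset.antisymm (fun b hb => ⟨b, hBA hb, ha.condExp_of_mem (hB hb)⟩)
    (Set.image_subset_iff.mpr hE)

end CoarseModule

end CoarseGeom

theorem mainTheorem4 {X : Type*} [CoarseGeom.CoarseSpace X]
    {H : Type*} [NormedAddCommGroup H] [InnerProductSpace ℂ H] [CompleteSpace H]
    (M : CoarseGeom.CoarseModule X H)
    (hX : CoarseGeom.HasBoundedGeometry X) (hM : M.IsDiscrete)
    {I : Type*} (a : I → M.meas) (ha : M.IsDiscretePartition a)
    (hulf : CoarseGeom.IsUniformlyLocallyFinite fun i => (a i : Set X)) :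
    ((M.prodBounded a : Set (H →L[ℂ] H)) = M.condExp ha '' (M.cpCStar : Set (H →L[ℂ] H)) ∧
      CoarseGeom.IsNCCartan (M.prodBounded a) M.cpCStar) ∧
    ((M.prodCompact a : Set (H →L[ℂ] H)) = M.condExp ha '' (M.roeCStar : Set (H →L[ℂ] H)) ∧
      CoarseGeom.IsNCCartan (M.prodCompact a) M.roeCStar) := by
  have h1 := CoarseGeom.CoarseModule.isNCCartan_prodBounded ha hulf
  have h2 := CoarseGeom.CoarseModule.isNCCartan_prodCompact ha hulf
  refine ⟨⟨CoarseGeom.CoarseModule.condExp_image_eq ha le_rfl h1.le fun x _ =>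
    ha.condExp_mem_prodBounded x, h1⟩,
    ⟨CoarseGeom.CoarseModule.condExp_image_eq ha
      CoarseGeom.CoarseModule.prodCompact_le_prodBounded h2.le fun x hx =>
        ha.condExp_mem_prodCompact
          (CoarseGeom.CoarseModule.isCompactOperator_block_of_mem_roeCStar ha hx), h2⟩⟩
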